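/- Work in real-valued continuous logic. A signature $L$ consists of function and predicate symbols of finite arity, a bound $D$ for the diameter, a modulus of uniform continuity for every symbol, and a bounded closed interval $I_P$ for every predicate symbol $P$. An $L$-structure is a nonempty complete metric space of diameter at most $D$, with functions and $I_P$-valued predicates interpreting the symbols and respecting the moduli (with respect to the maximum metric on tuples). Formulas are built from the atomic formulas $d(s,t)$ and $P(t_1,\dots,t_n)$ by all continuous connectives $\mathbb{R}^k\to\mathbb{R}$, $k\ge 0$, and the quantifiers $\sup_x$, $\inf_x$; statements are the expressions $\varphi=r$ and $\varphi\ge r$ with $\varphi$ a formula and $r\in\mathbb{R}$. Let $M$ be an $L$-structure, $A\subseteq M$, let $L(A)$ be $L$ with a constant symbol for each element of $A$, and let $T_A=\mathrm{Th}(M,a)_{a\in A}$ be the set of closed $L(A)$-statements true in $M$. A set $p(x)$ of $L(A)$-statements in one free variable $x$ is a type over $A$ if $p(x)\cup T_A$ is satisfiable, i.e. if some element of some model of $T_A$ satisfies all statements of $p(x)$. A complete type over $A$ is a maximal type over $A$, and $S^M(A)$ is the set of complete types over $A$. For an elementary extension $N$ of $M$ and $a\in N$, $\mathrm{tp}^N(a/A)$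 is the set of all $L(A)$-statements in $x$ satisfied in $N$ by $a$. Let $\mathcal{L}_A$ be the Riesz space of all interpretations $\varphi^M:M\to\mathbb{R}$ of $L(A)$-formulas $\varphi(x)$, with the pointwise operations, and let the spectrum $\sigma_A(M)$ be the set of Riesz homomorphisms (linear maps preserving the lattice operations) $I:\mathcal{L}_A\to\mathbb{R}$ with $I(\mathbf{1})=1$. **Proposition.** (i) For every $p\in S^M(A)$ there is an $I_p\in\sigma_A(M)$ such that, for all $L(A)$-formulas $\varphi(x)$ and all $r\in\mathbb{R}$, $I_p(\varphi^M)=r$ if and only if the statement $\varphi=r$ belongs to $p$; and the map $S^M(A)\to\sigma_A(M)$, $p\mapsto I_p$, so defined is a bijection. (ii) A set $p$ of $L(A)$-statements in the variable $x$ is in $S^M(A)$ if and only if there are an elementary extension $N$ of $M$ and $a\in N$ such that $p=\mathrm{tp}^N(a/A)$. -/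

import Mathlib

universe u v w

/-- A modulus of uniform continuity: a function sending every `ε > 0` to some `Δ ε > 0`. -/
def ModulusOfContinuity : Type := {Δ : ℝ → ℝ // ∀ ε > 0, 0 < Δ ε}

/-- `f` obeys the modulus `Δ`: `d(x,y) < Δ(ε)` implies `d(f x, f y) ≤ ε`, for all `ε > 0`. -/
def ModulusOfContinuity.Controls {X Y : Type*} [PseudoMetricSpace X] [PseudoMetricSpace Y]
    (Δ : ModulusOfContinuity) (f : X → Y) : Prop :=
  ∀ ε > 0, ∀ x y : X, dist x y < Δ.1 ε → dist (f x) (f y) ≤ ε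

/-- A (one-sorted) signature of real-valued continuous logic: function and predicate symbols with
their arities, a bound for the diameter, a modulus of uniform continuity for every symbol, and a
bounded interval `[relLo R, relHi R]` of values for every predicate symbol `R`. -/
structure MetricLanguage extends FirstOrder.Language.{u, v} where
  diam : ℝ
  funMod : ∀ {n : ℕ}, Functions n → ModulusOfContinuity
  relMod : ∀ {n : ℕ}, Relations n → ModulusOfContinuity
  relLo : ∀ {n : ℕ}, Relations n → ℝ
  relHi : ∀ {n : ℕ}, Relations n → ℝ

namespace MetricLanguage

/-- A metric structure for `L` on the metric space `M`. Tuples carry the maximum metric. -/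
structure MetricStructure (L : MetricLanguage.{u, v}) (M : Type w) [MetricSpace M] where
  nonempty : Nonempty M
  complete : CompleteSpace M
  dist_le : ∀ x y : M, dist x y ≤ L.diam
  funMap : ∀ {n : ℕ}, L.Functions n → (Fin n → M) → M
  relMap : ∀ {n : ℕ}, L.Relations n → (Fin n → M) → ℝ
  funMap_controls : ∀ {n : ℕ} (f : L.Functions n), (L.funMod f).Controls (funMap f)
  relMap_controls : ∀ {n : ℕ} (R : L.Relations n), (L.relMod R).Controls (relMap R)
  relMap_mem : ∀ {n : ℕ} (R : L.Relations n) (x : Fin n → M),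
    relMap R x ∈ Set.Icc (L.relLo R) (L.relHi R)

/-- Formulas of continuous logic whose free variables are among `x₀, …, xₙ₋₁`. Every continuous
function `ℝᵏ → ℝ` is a connective; the quantifiers `sup` and `inf` bind the last variable. -/
inductive Formula (L : MetricLanguage.{u, v}) : ℕ → Type (max u v)
  | dist {n : ℕ} (s t : L.toLanguage.Term (Fin n)) : Formula L n
  | rel {n k : ℕ} (R : L.Relations k) (ts : Fin k → L.toLanguage.Term (Fin n)) : Formula L n
  | conn {n k : ℕ} (c : C(Fin k → ℝ, ℝ)) (φ : Fin k → Formula L n) : Formula L n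
  | sup {n : ℕ} (φ : Formula L (n + 1)) : Formula L n
  | inf {n : ℕ} (φ : Formula L (n + 1)) : Formula L n

section Semantics

variable {L : MetricLanguage.{u, v}} {M : Type w} [MetricSpace M]

/-- The value of a term. -/
def MetricStructure.termVal (S : L.MetricStructure M) {n : ℕ} (x : Fin n → M) :
    L.toLanguage.Term (Fin n) → M
  | .var i => x i
  | .func f ts => S.funMap f (fun i => S.termVal x (ts i))

/-- The value of a formula: its interpretation as a real-valued function on `Mⁿ`. -/
noncomputable def MetricStructure.val (S : L.MetricStructure M) :
    {n : ℕ} → L.Formula n → (Fin n → M) → ℝ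
  | _, .dist s t, x => Dist.dist (S.termVal x s) (S.termVal x t)
  | _, .rel R ts, x => S.relMap R (fun i => S.termVal x (ts i))
  | _, .conn c φ, x => c (fun i => S.val (φ i) x)
  | _, .sup φ, x => ⨆ a : M, S.val φ (Fin.snoc x a)
  | _, .inf φ, x => ⨅ a : M, S.val φ (Fin.snoc x a)

/-- Every formula has a bound valid in all structures, so the suprema and infima in
`MetricStructure.val` are always those of nonempty bounded sets of reals. -/
theorem exists_bound {n : ℕ} (φ : L.Formula n) :
    ∃ B : ℝ, ∀ (M : Type w) [MetricSpace M] (S : L.MetricStructure M) (x : Fin n → M),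
      |S.val φ x| ≤ B := by
  induction φ with
  | dist s t =>
    refine ⟨L.diam, fun M _ S x => ?_⟩
    rw [MetricStructure.val, abs_of_nonneg dist_nonneg]
    exact S.dist_le _ _
  | rel R ts =>
    refine ⟨max |L.relLo R| |L.relHi R|, fun M _ S x => ?_⟩
    rw [MetricStructure.val]
    exact abs_le_max_abs_abs (S.relMap_mem R _).1 (S.relMap_mem R _).2
  | conn c φ ih =>
    choose B hB using ih
    have hK : IsCompact (Set.univ.pi fun i => Set.Icc (-(B i)) (B i)) :=
      isCompact_univ_pi fun i => isCompact_Icc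
    obtain ⟨C, hC⟩ := hK.exists_bound_of_continuousOn c.continuous.continuousOn
    refine ⟨C, fun M _ S x => ?_⟩
    rw [MetricStructure.val]
    exact hC _ fun i _ => abs_le.mp (hB i M S x)
  | sup φ ih =>
    obtain ⟨B, hB⟩ := ih
    refine ⟨B, fun M _ S x => ?_⟩
    have := S.nonempty
    have h := fun a => abs_le.mp (hB M S (Fin.snoc x a))
    rw [MetricStructure.val, abs_le]
    obtain ⟨a⟩ := S.nonempty
    exact ⟨(h a).1.trans (le_ciSup (f := fun a => S.val φ (Fin.snoc x a))
      ⟨B, by rintro _ ⟨b, rfl⟩; exact (h b).2⟩ a), ciSup_le fun b => (h b).2⟩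
  | inf φ ih =>
    obtain ⟨B, hB⟩ := ih
    refine ⟨B, fun M _ S x => ?_⟩
    have := S.nonempty
    have h := fun a => abs_le.mp (hB M S (Fin.snoc x a))
    rw [MetricStructure.val, abs_le]
    obtain ⟨a⟩ := S.nonempty
    exact ⟨le_ciInf fun b => (h b).1, (ciInf_le (f := fun a => S.val φ (Fin.snoc x a))
      ⟨-B, by rintro _ ⟨b, rfl⟩; exact (h b).1⟩ a).trans (h a).2⟩

end Semantics

/-- Statements (conditions) in the variables `x₀, …, xₙ₋₁`: `φ = r` and `φ ≥ r`. -/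
inductive Statement (L : MetricLanguage.{u, v}) (n : ℕ) : Type (max u v)
  | eq (φ : L.Formula n) (r : ℝ) : Statement L n
  | ge (φ : L.Formula n) (r : ℝ) : Statement L n

/-- The tuple `x` satisfies a statement in the structure `S`. -/
def MetricStructure.Satisfies {L : MetricLanguage.{u, v}} {M : Type w} [MetricSpace M]
    (S : L.MetricStructure M) {n : ℕ} (x : Fin n → M) : L.Statement n → Prop
  | .eq φ r => S.val φ x = r
  | .ge φ r => S.val φ x ≥ r

/-- An elementary embedding: it preserves the values of all formulas (hence it is isometric and
commutes with the function symbols). -/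
def IsElementaryEmbedding {L : MetricLanguage.{u, v}} {M N : Type w} [MetricSpace M]
    [MetricSpace N] (S : L.MetricStructure M) (S' : L.MetricStructure N) (j : M → N) : Prop :=
  ∀ (n : ℕ) (φ : L.Formula n) (x : Fin n → M), S'.val φ (j ∘ x) = S.val φ x

/-- The language `L(A)`: `L` with a new constant symbol for every element of `A`. -/
def withConstants (L : MetricLanguage.{u, v}) (A : Type w) : MetricLanguage.{max u w, v} where
  toLanguage := L.toLanguage.withConstants A
  diam := L.diam
  funMod := Sum.elim L.funMod (fun _ => ⟨fun _ => 1, fun _ _ => one_pos⟩)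
  relMod := Sum.elim L.relMod (fun r => isEmptyElim r)
  relLo := Sum.elim L.relLo (fun r => isEmptyElim r)
  relHi := Sum.elim L.relHi (fun r => isEmptyElim r)

/-- The interpretation in `N` of the function symbols of arity `n` that only consist of constants
for the elements of `A`, the constant for `a` being interpreted as `c a`. -/
def constMap {A N : Type w} (c : A → N) :
    {n : ℕ} → (FirstOrder.Language.constantsOn A).Functions n → N
  | 0, a => c a
  | _ + 1, f => PEmpty.elim f

/-- The expansion of an `L`-structure to an `L(A)`-structure in which the constant for `a ∈ A` is
interpreted as `c a`. -/
def MetricStructure.expand {L : MetricLanguage.{u, v}} {A N : Type w} [MetricSpace N]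
    (S : L.MetricStructure N) (c : A → N) : (L.withConstants A).MetricStructure N where
  nonempty := S.nonempty
  complete := S.complete
  dist_le := S.dist_le
  funMap := Sum.elim S.funMap (fun f _ => constMap c f)
  relMap := Sum.elim S.relMap (fun r => isEmptyElim r)
  funMap_controls := by
    rintro n (f | f)
    · exact S.funMap_controls f
    · intro ε hε x y _
      simpa using hε.le
  relMap_controls := by
    rintro n (R | R)
    · exact S.relMap_controls R
    · exact isEmptyElim R
  relMap_mem := by
    rintro n (R | R)
    · exact S.relMap_mem R
    · exact isEmptyElim R

section Types

variable {L : MetricLanguage.{u, v}} {M : Type w} [MetricSpace M]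

/-- `M` as an `L(A)`-structure: every `a ∈ A` is interpreted as itself. -/
def MetricStructure.over (S : L.MetricStructure M) (A : Set M) :
    (L.withConstants A).MetricStructure M :=
  S.expand (fun a : A => (a : M))

/-- `T_A = Th(M, a)_{a ∈ A}`: the closed `L(A)`-statements true in `M`. -/
def theoryOver (S : L.MetricStructure M) (A : Set M) : Set ((L.withConstants A).Statement 0) :=
  {s | (S.over A).Satisfies Fin.elim0 s}

/-- `p(x) ∪ T_A` is satisfiable: some `L(A)`-structure `N` is a model of `T_A` and has an element
satisfying all the statements of `p(x)`. -/
def IsTypeOver (S : L.MetricStructure M) (A : Set M)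
    (p : Set ((L.withConstants A).Statement 1)) : Prop :=
  ∃ (N : Type w) (_ : MetricSpace N) (S' : (L.withConstants A).MetricStructure N),
    (∀ s ∈ theoryOver S A, S'.Satisfies Fin.elim0 s) ∧
    ∃ b : N, ∀ s ∈ p, S'.Satisfies (fun _ => b) s

/-- The set `S^M(A)` of complete types over `A`, i.e. of maximal types over `A`. -/
def completeTypes (S : L.MetricStructure M) (A : Set M) :
    Set (Set ((L.withConstants A).Statement 1)) :=
  {p | Maximal (IsTypeOver S A) p}

/-- `tp^N(b/A)`, where the elements of `A` are viewed in `N` through the map `j`. -/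
def typeOf {N : Type w} [MetricSpace N] (S' : L.MetricStructure N) (A : Set M) (j : M → N)
    (b : N) : Set ((L.withConstants A).Statement 1) :=
  {s | (S'.expand (fun a : A => j a)).Satisfies (fun _ => b) s}

/-- The interpretation `φ^M : M → ℝ` of an `L(A)`-formula `φ(x)`. -/
noncomputable def interp (S : L.MetricStructure M) (A : Set M)
    (φ : (L.withConstants A).Formula 1) : M → ℝ :=
  fun b => (S.over A).val φ (fun _ => b)

theorem exists_interp_conn (S : L.MetricStructure M) (A : Set M) {k : ℕ} (c : C(Fin k → ℝ, ℝ))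
    (φ : Fin k → (L.withConstants A).Formula 1) :
    ∃ ψ, interp S A ψ = fun b => c (fun i => interp S A (φ i) b) :=
  ⟨.conn c φ, rfl⟩

/-- The space of all interpretations `φ^M` of `L(A)`-formulas `φ(x)`, as a space of functions. -/
noncomputable def interpSpace (S : L.MetricStructure M) (A : Set M) : Submodule ℝ (M → ℝ) where
  carrier := Set.range (interp S A)
  add_mem' := by
    rintro _ _ ⟨φ, rfl⟩ ⟨ψ, rfl⟩
    exact exists_interp_conn S A ⟨fun t => t 0 + t 1, by fun_prop⟩ ![φ, ψ]
  zero_mem' := exists_interp_conn S A (k := 0) ⟨fun _ => 0, by fun_prop⟩ Fin.elim0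
  smul_mem' := by
    rintro r _ ⟨φ, rfl⟩
    exact exists_interp_conn S A ⟨fun t => r * t 0, by fun_prop⟩ ![φ]

theorem interp_mem (S : L.MetricStructure M) (A : Set M) (φ : (L.withConstants A).Formula 1) :
    interp S A φ ∈ interpSpace S A :=
  ⟨φ, rfl⟩

theorem one_mem_interpSpace (S : L.MetricStructure M) (A : Set M) :
    (1 : M → ℝ) ∈ interpSpace S A :=
  exists_interp_conn S A (k := 0) ⟨fun _ => 1, by fun_prop⟩ Fin.elim0

/-- The pointwise lattice operations on the space of interpretations. -/
noncomputable instance interpSpace.lattice (S : L.MetricStructure M) (A : Set M) :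
    Lattice (interpSpace S A) :=
  Subtype.lattice (P := fun f => f ∈ interpSpace S A)
    (by
      rintro _ _ ⟨φ, rfl⟩ ⟨ψ, rfl⟩
      exact exists_interp_conn S A ⟨fun t => t 0 ⊔ t 1, by fun_prop⟩ ![φ, ψ])
    (by
      rintro _ _ ⟨φ, rfl⟩ ⟨ψ, rfl⟩
      exact exists_interp_conn S A ⟨fun t => t 0 ⊓ t 1, by fun_prop⟩ ![φ, ψ])

end Types

end MetricLanguage

/-- A Riesz homomorphism: a linear map preserving the lattice operations. -/
structure RieszHom (E F : Type*) [AddCommGroup E] [Module ℝ E] [Lattice E]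
    [AddCommGroup F] [Module ℝ F] [Lattice F] extends E →ₗ[ℝ] F where
  map_sup : ∀ f g : E, toFun (f ⊔ g) = toFun f ⊔ toFun g
  map_inf : ∀ f g : E, toFun (f ⊓ g) = toFun f ⊓ toFun g

namespace MetricLanguage

/-- The spectrum `σ_A(M)`: the Riesz homomorphisms `I` from the space of interpretations of
`L(A)`-formulas to `ℝ` with `I(1) = 1`. -/
def spectrumOver {L : MetricLanguage.{u, v}} {M : Type w} [MetricSpace M]
    (S : L.MetricStructure M) (A : Set M) : Set (RieszHom (interpSpace S A) ℝ) :=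
  {I | I.toLinearMap ⟨1, one_mem_interpSpace S A⟩ = 1}

end MetricLanguage

/-! An element `b` of a model of T_A yields the functional φ^M ↦ φ(b). It is well defined because
φ^M = ψ^M amounts to the closed statement sup |φ − ψ| = 0 of T_A (`val_eq_of_interp_eq`), and it is
a Riesz homomorphism because sums, multiples, maxima and minima are connectives. The statements true
at `b` fix the value of every formula, so they form a maximal type, and every maximal type arises in
this way. Hence p ↦ I_p exists and is injective.

Surjectivity and (ii) both need a point realizing a given I. The sets where g < 1, for g in the
kernel of I, generate a filter on M, and I is the limit along any finer ultrafilter U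
(`exists_ultrafilter_tendsto`). In the metric ultrapower of M along U, Łoś's theorem gives the class
of the identity family M → M the value lim_U φ^M = I(φ^M) for every φ, and the diagonal embedding is
elementary. Applied to I_p, this realizes p in an elementary extension; no separate compactness
theorem is needed. -/

namespace MetricLanguage

open Filter Topology

/-! ### Limits of real families along an ultrafilter -/

section Ultralimit

variable {ι : Type*} (U : Ultrafilter ι)

/-- The limit of a family of real numbers along an ultrafilter; meaningful for bounded families. -/
noncomputable def ultralimit (f : ι → ℝ) : ℝ := limUnder (U : Filter ι) f

variable {U}

theorem tendsto_ultralimit {f : ι → ℝ} {a b : ℝ} (hf : ∀ i, f i ∈ Set.Icc a b) :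
    Tendsto f U (𝓝 (ultralimit U f)) := by
  obtain ⟨x, -, hx⟩ := (isCompact_Icc (a := a) (b := b)).ultrafilter_le_nhds (U.map f)
    (le_principal_iff.2 (Filter.mem_map.2 (Filter.univ_mem' hf)))
  exact tendsto_nhds_limUnder ⟨x, hx⟩

/-- Suprema of uniformly bounded families commute with limits along an ultrafilter. -/
theorem tendsto_iSup_of_tendsto {M N : Type*} [Nonempty M] {q : (ι → M) → N}
    (hq : Function.Surjective q) {f : ι → M → ℝ} {F : N → ℝ} {B : ℝ} (hB : ∀ i a, |f i a| ≤ B)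
    (h : ∀ y : ι → M, Tendsto (fun i => f i (y i)) U (𝓝 (F (q y)))) :
    Tendsto (fun i => ⨆ a, f i a) U (𝓝 (⨆ b, F b)) := by
  have hbdd : ∀ i, BddAbove (Set.range (f i)) := fun i =>
    ⟨B, by rintro _ ⟨a, rfl⟩; exact (abs_le.1 (hB i a)).2⟩
  have hs : Tendsto (fun i => ⨆ a, f i a) U (𝓝 (ultralimit U fun i => ⨆ a, f i a)) := by
    refine tendsto_ultralimit (a := -B) (b := B) fun i =>
      ⟨?_, ciSup_le fun a => (abs_le.1 (hB i a)).2⟩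
    exact (abs_le.1 (hB i (Classical.arbitrary M))).1.trans (le_ciSup (hbdd i) _)
  set l := ultralimit U fun i => ⨆ a, f i a
  have hle : ∀ b, F b ≤ l := by
    intro b
    obtain ⟨y, rfl⟩ := hq b
    exact le_of_tendsto_of_tendsto' (h y) hs fun i => le_ciSup (hbdd i) (y i)
  have : Nonempty N := ⟨q fun _ => Classical.arbitrary M⟩
  convert hs using 2
  refine le_antisymm (ciSup_le hle) (le_of_forall_pos_le_add fun ε hε => ?_)
  -- Near-maximizers chosen index by index form a single family, whose class is one point of `N`
  -- with value at least `l - ε`.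
  have hy : ∀ i, ∃ a, (⨆ a, f i a) - ε < f i a := fun i => exists_lt_of_lt_ciSup (by linarith)
  choose y hy using hy
  have h1 : l - ε ≤ F (q y) :=
    le_of_tendsto_of_tendsto' (hs.sub_const ε) (h y) fun i => (hy i).le
  have h2 : F (q y) ≤ ⨆ b, F b := le_ciSup ⟨l, by rintro _ ⟨b, rfl⟩; exact hle b⟩ _
  linarith

theorem iInf_eq_neg_iSup_neg {α : Type*} (f : α → ℝ) : ⨅ a, f a = -⨆ a, -f a := by
  rw [iInf, iSup, Real.sInf_def]
  congr 2
  ext x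
  simp [neg_eq_iff_eq_neg]

/-- Infima of uniformly bounded families commute with limits along an ultrafilter. -/
theorem tendsto_iInf_of_tendsto {M N : Type*} [Nonempty M] {q : (ι → M) → N}
    (hq : Function.Surjective q) {f : ι → M → ℝ} {F : N → ℝ} {B : ℝ} (hB : ∀ i a, |f i a| ≤ B)
    (h : ∀ y : ι → M, Tendsto (fun i => f i (y i)) U (𝓝 (F (q y)))) :
    Tendsto (fun i => ⨅ a, f i a) U (𝓝 (⨅ b, F b)) := by
  simp only [iInf_eq_neg_iSup_neg]
  exact (tendsto_iSup_of_tendsto hq (f := fun i a => -f i a) (F := fun b => -F b) (B := B)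
    (by simpa using hB) fun y => (h y).neg).neg

end Ultralimit

/-! ### The metric ultrapower and its completeness -/

section Ultrapower

/-- Families of elements of `M`, with the distance of the metric ultrapower. -/
def UltraFamily {ι : Type*} (_ : Ultrafilter ι) (M : Type*) : Type _ := ι → M

variable {ι : Type*} {U : Ultrafilter ι} {M : Type*} [MetricSpace M] [BoundedSpace M]

theorem tendsto_dist_ultralimit (x y : ι → M) :
    Tendsto (fun i => dist (x i) (y i)) U (𝓝 (ultralimit U fun i => dist (x i) (y i))) :=
  tendsto_ultralimit (a := 0) (b := Metric.diam (Set.univ : Set M)) fun _ =>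
    ⟨dist_nonneg, Metric.dist_le_diam_of_mem (Bornology.IsBounded.all _) trivial trivial⟩

noncomputable instance : PseudoMetricSpace (UltraFamily U M) where
  dist x y := ultralimit U fun i => dist (x i) (y i)
  dist_self x := tendsto_nhds_unique (tendsto_dist_ultralimit x x) (by simp)
  dist_comm x y := by simp only [dist_comm]
  dist_triangle x y z := le_of_tendsto_of_tendsto' (tendsto_dist_ultralimit x z)
    ((tendsto_dist_ultralimit x y).add (tendsto_dist_ultralimit y z)) fun i => dist_triangle _ _ _

theorem UltraFamily.tendsto_dist (x y : UltraFamily U M) :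
    Tendsto (fun i => dist (x i) (y i)) U (𝓝 (dist x y)) :=
  tendsto_dist_ultralimit x y

theorem UltraFamily.dist_le {x y : UltraFamily U M} {ε : ℝ}
    (h : ∀ᶠ i in (U : Filter ι), dist (x i) (y i) ≤ ε) : dist x y ≤ ε :=
  le_of_tendsto (UltraFamily.tendsto_dist x y) h

theorem UltraFamily.eventually_dist_lt {x y : UltraFamily U M} {ε : ℝ} (h : dist x y < ε) :
    ∀ᶠ i in (U : Filter ι), dist (x i) (y i) < ε :=
  (UltraFamily.tendsto_dist x y).eventually_lt_const h

/-- A sequence in a complete metric space has a point that is close to its initial segments of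
rapidly decreasing steps. -/
theorem exists_dist_le_of_rapid_initial_segment {X : Type*} [MetricSpace X] [CompleteSpace X]
    (u : ℕ → X) :
    ∃ y, ∀ n, (∀ k < n, dist (u k) (u (k + 1)) ≤ 1 / 2 / 2 ^ k) → dist (u n) y ≤ 1 / 2 ^ n := by
  classical
  -- `v` follows `u` up to its first step that is too long and stays there forever, so it is always
  -- Cauchy.
  let v : ℕ → X := fun n => Nat.rec (u 0) (fun n w =>
    if ∀ k < n + 1, dist (u k) (u (k + 1)) ≤ 1 / 2 / 2 ^ k then u (n + 1) else w) n
  have hv : ∀ n, v (n + 1) =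
    if ∀ k < n + 1, dist (u k) (u (k + 1)) ≤ 1 / 2 / 2 ^ k then u (n + 1) else v n := fun n => rfl
  have hvu : ∀ n, (∀ k < n, dist (u k) (u (k + 1)) ≤ 1 / 2 / 2 ^ k) → v n = u n := by
    rintro (_ | n) h
    · rfl
    · rw [hv, if_pos h]
  have hd : ∀ n, dist (v n) (v (n + 1)) ≤ 1 / 2 / 2 ^ n := by
    intro n
    by_cases h : ∀ k < n + 1, dist (u k) (u (k + 1)) ≤ 1 / 2 / 2 ^ k
    · rw [hvu _ h, hvu n fun k hk => h k (by omega)]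
      exact h n (by omega)
    · rw [hv, if_neg h, dist_self]
      positivity
  obtain ⟨y, hy⟩ := cauchySeq_tendsto_of_complete (cauchySeq_of_le_geometric_two hd)
  exact ⟨y, fun n h => hvu n h ▸ dist_le_of_le_geometric_two_of_tendsto hd hy n⟩

/-- Take a sequence of classes with rapidly decreasing steps. For each `n`, almost every coordinate
has its first `n` steps short, so there the limit of the truncated coordinate sequence is within `1
/ 2 ^ n` of the `n`-th term. These limits form the limit family; the set of good coordinates may
shrink with `n`, and no assumption on the ultrafilter is needed. -/
instance [CompleteSpace M] : CompleteSpace (UltraFamily U M) := by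
  refine Metric.complete_of_convergent_controlled_sequences (fun n => 1 / 2 / 2 ^ n)
    (fun n => by positivity) fun u hu => ?_
  choose y hy using fun i => exists_dist_le_of_rapid_initial_segment fun n => u n i
  have hle : ∀ n, dist (u n) (y : UltraFamily U M) ≤ 1 / 2 ^ n := by
    intro n
    have : ∀ᶠ i in (U : Filter ι), ∀ k ∈ Set.Iio n, dist (u k i) (u (k + 1) i) < 1 / 2 / 2 ^ k :=
      (eventually_all_finite (Set.finite_Iio n)).2 fun k _ =>
        UltraFamily.eventually_dist_lt (hu k k (k + 1) le_rfl (Nat.le_succ k))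
    exact UltraFamily.dist_le (this.mono fun i hi => hy i n fun k hk => (hi k hk).le)
  refine ⟨y, tendsto_iff_dist_tendsto_zero.2 (squeeze_zero (fun _ => dist_nonneg) hle ?_)⟩
  simpa using tendsto_pow_atTop_nhds_zero_of_lt_one (r := (1 / 2 : ℝ)) (by norm_num) (by norm_num)

variable (U M) in
/-- The metric ultrapower of `M`. -/
abbrev Ultrapower : Type _ := SeparationQuotient (UltraFamily U M)

variable (U) in
/-- The element of the ultrapower represented by a family of elements of `M`. -/
noncomputable def ultraMk (x : ι → M) : Ultrapower U M := SeparationQuotient.mk (X := UltraFamily U M) x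

theorem ultraMk_surjective : Function.Surjective (ultraMk U : (ι → M) → Ultrapower U M) :=
  SeparationQuotient.surjective_mk (X := UltraFamily U M)

/-- A family representing an element of the ultrapower. -/
noncomputable def ultraRep (z : Ultrapower U M) : ι → M :=
  Function.surjInv ultraMk_surjective z

@[simp]
theorem ultraMk_ultraRep (z : Ultrapower U M) : ultraMk U (ultraRep z) = z :=
  Function.surjInv_eq _ z

theorem tendsto_dist_ultraMk (x y : ι → M) :
    Tendsto (fun i => dist (x i) (y i)) U (𝓝 (dist (ultraMk U x) (ultraMk U y))) :=
  tendsto_dist_ultralimit x y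

/-- If finitely many pairs of families are at distance less than `δ` in the ultrapower, then so are
the corresponding tuples of members, eventually. -/
theorem eventually_dist_tuple_lt {n : ℕ} {x y : Fin n → ι → M} {δ : ℝ} (hδ : 0 < δ)
    (h : dist (fun k => ultraMk U (x k)) (fun k => ultraMk U (y k)) < δ) :
    ∀ᶠ i in (U : Filter ι), dist (fun k => x k i) (fun k => y k i) < δ := by
  have h' := (dist_pi_lt_iff hδ).1 h
  have : ∀ᶠ i in (U : Filter ι), ∀ k, dist (x k i) (y k i) < δ :=
    eventually_all.2 fun k => (tendsto_dist_ultraMk (x k) (y k)).eventually_lt_const (h' k)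
  exact this.mono fun i hi => (dist_pi_lt_iff hδ).2 hi

/-- The strict hypothesis of a modulus passes from the limit to almost all indices, and its weak
conclusion passes back to the limit. So the ultrapower obeys the same moduli, and symbols act
independently of representatives. -/
theorem ModulusOfContinuity.Controls.dist_ultraMk_le {n : ℕ} {Δ : ModulusOfContinuity}
    {F : (Fin n → M) → M} (hF : Δ.Controls F) {x y : Fin n → ι → M} {ε : ℝ} (hε : 0 < ε)
    (h : dist (fun k => ultraMk U (x k)) (fun k => ultraMk U (y k)) < Δ.1 ε) :
    dist (ultraMk U fun i => F fun k => x k i) (ultraMk U fun i => F fun k => y k i) ≤ ε :=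
  le_of_tendsto (tendsto_dist_ultraMk _ _) ((eventually_dist_tuple_lt (Δ.2 ε hε) h).mono fun _ hi =>
    hF ε hε _ _ hi)

theorem ModulusOfContinuity.Controls.dist_le_of_tendsto {n : ℕ} {Δ : ModulusOfContinuity}
    {F : (Fin n → M) → ℝ} (hF : Δ.Controls F) {x y : Fin n → ι → M} {a b : ℝ}
    (ha : Tendsto (fun i => F fun k => x k i) U (𝓝 a))
    (hb : Tendsto (fun i => F fun k => y k i) U (𝓝 b)) {ε : ℝ} (hε : 0 < ε)
    (h : dist (fun k => ultraMk U (x k)) (fun k => ultraMk U (y k)) < Δ.1 ε) :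
    dist a b ≤ ε :=
  le_of_tendsto (ha.dist hb) ((eventually_dist_tuple_lt (Δ.2 ε hε) h).mono fun _ hi =>
    hF ε hε _ _ hi)

end Ultrapower

/-! ### The ultrapower as a structure, and Łoś's theorem -/

section UltrapowerStructure

variable {L : MetricLanguage.{u, v}} {M : Type w} [MetricSpace M] [BoundedSpace M] {ι : Type w}

theorem MetricStructure.boundedSpace {M : Type w} [MetricSpace M] (S : L.MetricStructure M) :
    BoundedSpace M :=
  ⟨Metric.isBounded_iff.2 ⟨L.diam, fun _ _ _ _ => S.dist_le _ _⟩⟩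

theorem MetricStructure.tendsto_relMap {M : Type w} [MetricSpace M] (S : L.MetricStructure M)
    {U : Ultrafilter ι} {n : ℕ}
    (R : L.Relations n) (x : Fin n → ι → M) :
    Tendsto (fun i => S.relMap R fun k => x k i) U
      (𝓝 (ultralimit U fun i => S.relMap R fun k => x k i)) :=
  tendsto_ultralimit fun _ => S.relMap_mem R _

/-- The metric ultrapower of an `L`-structure. -/
noncomputable def MetricStructure.ultrapower (S : L.MetricStructure M) (U : Ultrafilter ι) :
    L.MetricStructure (Ultrapower U M) where
  nonempty := S.nonempty.map fun a => ultraMk U fun _ => a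
  complete := have := S.complete; inferInstance
  dist_le x y := by
    obtain ⟨x, rfl⟩ := ultraMk_surjective x
    obtain ⟨y, rfl⟩ := ultraMk_surjective y
    exact le_of_tendsto' (tendsto_dist_ultraMk x y) fun _ => S.dist_le _ _
  funMap f x := ultraMk U fun i => S.funMap f fun k => ultraRep (x k) i
  relMap R x := ultralimit U fun i => S.relMap R fun k => ultraRep (x k) i
  funMap_controls f ε hε x y h :=
    ModulusOfContinuity.Controls.dist_ultraMk_le (S.funMap_controls f) hε (by simpa using h)
  relMap_controls R ε hε x y h :=
    ModulusOfContinuity.Controls.dist_le_of_tendsto (U := U) (S.relMap_controls R)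
      (S.tendsto_relMap R _) (S.tendsto_relMap R _) hε (by simpa using h)
  relMap_mem R x := isClosed_Icc.mem_of_tendsto
    (S.tendsto_relMap (U := U) R fun k => ultraRep (x k))
    (Eventually.of_forall fun _ => S.relMap_mem R _)

variable (S : L.MetricStructure M) (U : Ultrafilter ι)

/-- The representatives picked by `ultraRep` are at distance zero from the given families, hence
closer than `Δ ε` for every `ε`, so the two values are at distance at most every `ε`. -/
theorem MetricStructure.ultrapower_funMap {n : ℕ} (f : L.Functions n) (x : Fin n → ι → M) :
    (S.ultrapower U).funMap f (fun k => ultraMk U (x k)) =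
      ultraMk U fun i => S.funMap f fun k => x k i := by
  refine dist_le_zero.1 (le_of_forall_pos_le_add fun ε hε => ?_)
  rw [zero_add]
  exact ModulusOfContinuity.Controls.dist_ultraMk_le (S.funMap_controls f) hε
    (by simpa using (L.funMod f).2 ε hε)

theorem MetricStructure.tendsto_ultrapower_relMap {n : ℕ} (R : L.Relations n)
    (x : Fin n → ι → M) :
    Tendsto (fun i => S.relMap R fun k => x k i) U
      (𝓝 ((S.ultrapower U).relMap R fun k => ultraMk U (x k))) := by
  convert S.tendsto_relMap (U := U) R x using 2
  refine dist_le_zero.1 (le_of_forall_pos_le_add fun ε hε => ?_)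
  rw [zero_add]
  exact ModulusOfContinuity.Controls.dist_le_of_tendsto (U := U) (S.relMap_controls R)
    (S.tendsto_relMap R _) (S.tendsto_relMap R _) hε (by simpa using (L.relMod R).2 ε hε)

theorem MetricStructure.ultrapower_termVal {n : ℕ} (x : Fin n → ι → M)
    (t : L.toLanguage.Term (Fin n)) :
    (S.ultrapower U).termVal (fun k => ultraMk U (x k)) t =
      ultraMk U fun i => S.termVal (fun k => x k i) t := by
  induction t with
  | var k => rfl
  | func f ts ih =>
    simp only [MetricStructure.termVal, ih]
    exact S.ultrapower_funMap U f _

/-- Łoś's theorem. -/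
theorem MetricStructure.tendsto_ultrapower_val {n : ℕ} (φ : L.Formula n) (x : Fin n → ι → M) :
    Tendsto (fun i => S.val φ fun k => x k i) U
      (𝓝 ((S.ultrapower U).val φ fun k => ultraMk U (x k))) := by
  have := S.nonempty
  have hsnoc : ∀ {n : ℕ} (x : Fin n → ι → M) (y : ι → M) (i : ι),
      (fun k => (Fin.snoc x y : Fin (n + 1) → ι → M) k i) = Fin.snoc (fun k => x k i) (y i) :=
    fun x y i => Fin.comp_snoc (fun z : ι → M => z i) x y
  have hsnoc' : ∀ {n : ℕ} (x : Fin n → ι → M) (y : ι → M),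
      (fun k => ultraMk U ((Fin.snoc x y : Fin (n + 1) → ι → M) k)) =
        Fin.snoc (fun k => ultraMk U (x k)) (ultraMk U y) :=
    fun x y => Fin.comp_snoc (ultraMk U) x y
  induction φ with
  | dist s t =>
    simp only [MetricStructure.val, MetricStructure.ultrapower_termVal]
    exact tendsto_dist_ultraMk _ _
  | rel R ts =>
    simp only [MetricStructure.val, MetricStructure.ultrapower_termVal]
    exact S.tendsto_ultrapower_relMap U R _
  | conn c φ ih =>
    simp only [MetricStructure.val]
    exact (c.continuous.tendsto _).comp (tendsto_pi_nhds.2 fun i => ih i x)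
  | sup φ ih =>
    obtain ⟨B, hB⟩ := exists_bound φ
    refine tendsto_iSup_of_tendsto ultraMk_surjective (fun _ _ => hB M S _) fun y => ?_
    simpa only [hsnoc, hsnoc'] using ih (Fin.snoc x y)
  | inf φ ih =>
    obtain ⟨B, hB⟩ := exists_bound φ
    refine tendsto_iInf_of_tendsto ultraMk_surjective (fun _ _ => hB M S _) fun y => ?_
    simpa only [hsnoc, hsnoc'] using ih (Fin.snoc x y)

/-- The diagonal embedding into an ultrapower is elementary. -/
theorem isElementaryEmbedding_ultrapower :
    IsElementaryEmbedding S (S.ultrapower U) fun a => ultraMk U fun _ => a :=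
  fun _ φ x => tendsto_nhds_unique (S.tendsto_ultrapower_val U φ fun k _ => x k) tendsto_const_nhds

end UltrapowerStructure

end MetricLanguage

theorem RieszHom.ext_apply {E F : Type*} [AddCommGroup E] [Module ℝ E] [Lattice E]
    [AddCommGroup F] [Module ℝ F] [Lattice F] {I J : RieszHom E F}
    (h : ∀ f, I.toLinearMap f = J.toLinearMap f) : I = J := by
  cases I
  cases J
  congr
  exact LinearMap.ext h

namespace MetricLanguage

open Filter Topology

/-! ### Eliminating constants in favour of parameters -/

section Constants

variable {L : MetricLanguage.{u, v}} {A : Type w}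

/-- A term of `L(A)` is a term of `L` with parameters from `A`. The free variables of the latter are
enumerated by `τ`. -/
theorem exists_term_withConstants {n : ℕ} (t : (L.withConstants A).toLanguage.Term (Fin n)) :
    ∃ s : Set A, s.Finite ∧ ∀ {k : ℕ} (τ : Fin k → A ⊕ Fin n), (∀ a ∈ s, Sum.inl a ∈ Set.range τ) →
      (∀ i, Sum.inr i ∈ Set.range τ) → ∃ t' : L.toLanguage.Term (Fin k),
        ∀ (N : Type w) [MetricSpace N] (S : L.MetricStructure N) (c : A → N) (x : Fin n → N),
          (S.expand c).termVal x t = S.termVal (Sum.elim c x ∘ τ) t' := by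
  induction t with
  | var i =>
    refine ⟨∅, Set.finite_empty, fun τ _ hτ => ?_⟩
    obtain ⟨j, hj⟩ := hτ i
    exact ⟨.var j, fun N _ S c x => by simp [MetricStructure.termVal, hj]⟩
  | @func l f ts ih =>
    choose s hs h using ih
    rcases f with f | f
    · refine ⟨⋃ i, s i, Set.finite_iUnion hs, fun τ hτ hτ' => ?_⟩
      choose ts' hts' using fun i =>
        h i τ (fun a ha => hτ a (Set.mem_iUnion_of_mem i ha)) hτ'
      refine ⟨.func f ts', fun N _ S c x => ?_⟩
      simp only [MetricStructure.termVal, hts']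
      rfl
    · match l, f with
      | 0, a =>
        refine ⟨{a}, Set.finite_singleton a, fun τ hτ _ => ?_⟩
        obtain ⟨j, hj⟩ := hτ a rfl
        refine ⟨.var j, fun N _ S c x => ?_⟩
        simp only [MetricStructure.termVal, Function.comp, hj]
        rfl
      | _ + 1, f => exact PEmpty.elim f

/-- Subformulas must be translated over a common list of variables before they can be combined. The
induction therefore allows every enumeration `τ` covering a finite set of constants and the free
variables, rather than producing one. The translation does not depend on the structure. -/
theorem exists_formula_withConstants_of_enumeration {n : ℕ} (φ : (L.withConstants A).Formula n) :
    ∃ s : Set A, s.Finite ∧ ∀ {k : ℕ} (τ : Fin k → A ⊕ Fin n), (∀ a ∈ s, Sum.inl a ∈ Set.range τ) →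
      (∀ i, Sum.inr i ∈ Set.range τ) → ∃ ψ : L.Formula k,
        ∀ (N : Type w) [MetricSpace N] (S : L.MetricStructure N) (c : A → N) (x : Fin n → N),
          (S.expand c).val φ x = S.val ψ (Sum.elim c x ∘ τ) := by
  -- Under a quantifier, the bound variable is appended as the last entry of the enumeration.
  have hrange : ∀ {n k : ℕ} {s : Set A} (τ : Fin k → A ⊕ Fin n),
      (∀ a ∈ s, Sum.inl a ∈ Set.range τ) → (∀ i, Sum.inr i ∈ Set.range τ) →
      let τ' : Fin (k + 1) → A ⊕ Fin (n + 1) :=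
        Fin.snoc (Sum.map id Fin.castSucc ∘ τ) (Sum.inr (Fin.last n))
      (∀ a ∈ s, Sum.inl a ∈ Set.range τ') ∧ (∀ i, Sum.inr i ∈ Set.range τ') := by
    intro n k s τ h h'
    refine ⟨fun a ha => ?_, fun i => Fin.lastCases ⟨Fin.last k, by simp⟩ (fun i => ?_) i⟩
    · obtain ⟨j, hj⟩ := h a ha
      exact ⟨j.castSucc, by simp [hj]⟩
    · obtain ⟨j, hj⟩ := h' i
      exact ⟨j.castSucc, by simp [hj]⟩
  have hsnoc : ∀ {n k : ℕ} (τ : Fin k → A ⊕ Fin n) {N : Type w} (c : A → N) (x : Fin n → N) (b : N),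
      Sum.elim c (Fin.snoc x b : Fin (n + 1) → N) ∘ (Fin.snoc (Sum.map id Fin.castSucc ∘ τ)
        (Sum.inr (Fin.last n)) : Fin (k + 1) → A ⊕ Fin (n + 1)) =
        Fin.snoc (Sum.elim c x ∘ τ) b := by
    intro n k τ N c x b
    rw [Fin.comp_snoc]
    congr 1
    · ext j
      rcases h : τ j with a | i <;> simp [h]
    · simp
  induction φ with
  | dist t₁ t₂ =>
    obtain ⟨s₁, hs₁, h₁⟩ := exists_term_withConstants t₁
    obtain ⟨s₂, hs₂, h₂⟩ := exists_term_withConstants t₂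
    refine ⟨s₁ ∪ s₂, hs₁.union hs₂, fun τ hτ hτ' => ?_⟩
    obtain ⟨t₁', ht₁⟩ := h₁ τ (fun a ha => hτ a (.inl ha)) hτ'
    obtain ⟨t₂', ht₂⟩ := h₂ τ (fun a ha => hτ a (.inr ha)) hτ'
    exact ⟨.dist t₁' t₂', fun N _ S c x => by simp only [MetricStructure.val, ht₁, ht₂]⟩
  | rel R ts =>
    choose s hs h using fun i => exists_term_withConstants (ts i)
    refine ⟨⋃ i, s i, Set.finite_iUnion hs, fun τ hτ hτ' => ?_⟩
    choose ts' hts' using fun i => h i τ (fun a ha => hτ a (Set.mem_iUnion_of_mem i ha)) hτ'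
    rcases R with R | R
    · refine ⟨.rel R ts', fun N _ S c x => ?_⟩
      simp only [MetricStructure.val, hts']
      rfl
    · exact isEmptyElim R
  | conn g φ ih =>
    choose s hs h using ih
    refine ⟨⋃ i, s i, Set.finite_iUnion hs, fun τ hτ hτ' => ?_⟩
    choose ψ hψ using fun i => h i τ (fun a ha => hτ a (Set.mem_iUnion_of_mem i ha)) hτ'
    exact ⟨.conn g ψ, fun N _ S c x => by simp only [MetricStructure.val, hψ]⟩
  | sup φ ih =>
    obtain ⟨s, hs, h⟩ := ih
    refine ⟨s, hs, fun τ hτ hτ' => ?_⟩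
    obtain ⟨ψ, hψ⟩ := h _ (hrange τ hτ hτ').1 (hrange τ hτ hτ').2
    exact ⟨.sup ψ, fun N _ S c x => by simp only [MetricStructure.val, hψ, hsnoc]⟩
  | inf φ ih =>
    obtain ⟨s, hs, h⟩ := ih
    refine ⟨s, hs, fun τ hτ hτ' => ?_⟩
    obtain ⟨ψ, hψ⟩ := h _ (hrange τ hτ hτ').1 (hrange τ hτ hτ').2
    exact ⟨.inf ψ, fun N _ S c x => by simp only [MetricStructure.val, hψ, hsnoc]⟩

/-- A formula of `L(A)` is a formula of `L` with parameters from `A`. -/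
theorem exists_formula_withConstants {n : ℕ} (φ : (L.withConstants A).Formula n) :
    ∃ (k : ℕ) (τ : Fin k → A ⊕ Fin n) (ψ : L.Formula k),
      ∀ (N : Type w) [MetricSpace N] (S : L.MetricStructure N) (c : A → N) (x : Fin n → N),
        (S.expand c).val φ x = S.val ψ (Sum.elim c x ∘ τ) := by
  obtain ⟨s, hs, h⟩ := exists_formula_withConstants_of_enumeration φ
  have := hs.fintype
  let e := (Fintype.equivFin (s ⊕ Fin n)).symm
  obtain ⟨ψ, hψ⟩ := h (Sum.map Subtype.val id ∘ e)
    (fun a ha => ⟨e.symm (.inl ⟨a, ha⟩), by simp⟩) (fun i => ⟨e.symm (.inr i), by simp⟩)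
  exact ⟨_, _, ψ, hψ⟩

/-- Elementary embeddings preserve formulas with parameters. -/
theorem IsElementaryEmbedding.val_expand {M N : Type w} [MetricSpace M] [MetricSpace N]
    {S : L.MetricStructure M} {S' : L.MetricStructure N} {j : M → N}
    (hj : IsElementaryEmbedding S S' j) (c : A → M) {n : ℕ} (φ : (L.withConstants A).Formula n)
    (x : Fin n → M) : (S'.expand (j ∘ c)).val φ (j ∘ x) = (S.expand c).val φ x := by
  obtain ⟨k, τ, ψ, h⟩ := exists_formula_withConstants φ
  rw [h, h, ← hj, ← Function.comp_assoc, Sum.comp_elim]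

/-- Łoś's theorem for formulas with parameters. -/
theorem MetricStructure.tendsto_ultrapower_expand_val {M ι : Type w} [MetricSpace M]
    [BoundedSpace M] (S : L.MetricStructure M) (U : Ultrafilter ι) (c : A → M) {n : ℕ}
    (φ : (L.withConstants A).Formula n) (x : Fin n → ι → M) :
    Tendsto (fun i => (S.expand c).val φ fun k => x k i) U
      (𝓝 (((S.ultrapower U).expand fun a => ultraMk U fun _ => c a).val φ
        fun k => ultraMk U (x k))) := by
  obtain ⟨k, τ, ψ, h⟩ := exists_formula_withConstants φ
  rw [h]
  -- The parameters enter Łoś's theorem as constant families.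
  convert S.tendsto_ultrapower_val U ψ (Sum.elim (fun a _ => c a) x ∘ τ) using 2 with i
  · rw [h]
    congr 1
    ext l
    rcases hl : τ l with a | m <;> simp [hl]
  · congr 1
    ext l
    rcases hl : τ l with a | m <;> simp [hl]

end Constants

/-- The statements satisfied by an element. -/
def statementsAt {L : MetricLanguage.{u, v}} {N : Type w} [MetricSpace N]
    (S : L.MetricStructure N) (b : N) : Set (L.Statement 1) :=
  {s | S.Satisfies (fun _ => b) s}

theorem statementsAt_eq_of_val_eq {L : MetricLanguage.{u, v}} {N N' : Type w} [MetricSpace N]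
    [MetricSpace N'] {S : L.MetricStructure N} {S' : L.MetricStructure N'} {b : N} {b' : N'}
    (h : ∀ φ : L.Formula 1, S.val φ (fun _ => b) = S'.val φ (fun _ => b')) :
    statementsAt S b = statementsAt S' b' := by
  ext (⟨φ, r⟩ | ⟨φ, r⟩) <;>
    simp only [statementsAt, Set.mem_ofPred_eq, MetricStructure.Satisfies, h]

/-! ### Types, points of models and the spectrum -/

section Spectrum

variable {L : MetricLanguage.{u, v}} {M : Type w} [MetricSpace M] {S : L.MetricStructure M}
  {A : Set M}

/-- Every element of the spectrum is the limit along an ultrafilter on the structure. -/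
theorem exists_ultrafilter_tendsto {I : RieszHom (interpSpace S A) ℝ} (hI : I ∈ spectrumOver S A) :
    ∃ U : Ultrafilter M, ∀ f : interpSpace S A, Tendsto f.1 U (𝓝 (I.toLinearMap f)) := by
  let one : interpSpace S A := ⟨1, one_mem_interpSpace S A⟩
  have h1 : I.toLinearMap one = 1 := hI
  let K := {g : interpSpace S A // I.toLinearMap g = 0}
  let V : K → Set M := fun g => {x | g.1.1 x < 1}
  have : Nonempty K := ⟨⟨0, map_zero _⟩⟩
  -- If `g ≥ 1` everywhere, then `1 ⊔ g = g`, and applying `I` gives `1 ⊔ 0 = 0`.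
  have hV : ∀ g, (V g).Nonempty := by
    intro g
    by_contra hg
    have hle : one ⊔ g.1 = g.1 := by
      refine Subtype.ext (funext fun x => sup_eq_right.2 ?_)
      exact not_lt.1 fun hx => hg ⟨x, hx⟩
    have := I.map_sup one g.1
    rw [hle] at this
    change I.toLinearMap g.1 = I.toLinearMap one ⊔ I.toLinearMap g.1 at this
    rw [g.2, h1] at this
    norm_num at this
  -- The kernel of a Riesz homomorphism is closed under `⊔`.
  have hdir : Directed (· ≥ ·) fun g => 𝓟 (V g) := by
    intro g g'
    refine ⟨⟨g.1 ⊔ g'.1, ?_⟩, principal_mono.2 fun x hx => ?_, principal_mono.2 fun x hx => ?_⟩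
    · refine (I.map_sup g.1 g'.1).trans ?_
      change I.toLinearMap g.1 ⊔ I.toLinearMap g'.1 = 0
      rw [g.2, g'.2, sup_idem]
    · exact lt_of_le_of_lt (le_sup_left : g.1.1 x ≤ g.1.1 x ⊔ g'.1.1 x) hx
    · exact lt_of_le_of_lt (le_sup_right : g'.1.1 x ≤ g.1.1 x ⊔ g'.1.1 x) hx
  have : NeBot (⨅ g, 𝓟 (V g)) :=
    iInf_neBot_of_directed' hdir fun g => principal_neBot_iff.2 (hV g)
  refine ⟨Ultrafilter.of (⨅ g, 𝓟 (V g)), fun f => Metric.tendsto_nhds.2 fun ε hε => ?_⟩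
  -- The absolute value `h ⊔ -h` lies in the kernel of `I`, and it is below 1 exactly where `f` is
  -- within `ε` of `I f`.
  let h := ε⁻¹ • (f - I.toLinearMap f • one)
  have hh : I.toLinearMap h = 0 := by simp [h, h1]
  have hK : I.toLinearMap (h ⊔ -h) = 0 := by
    refine (I.map_sup h (-h)).trans ?_
    change I.toLinearMap h ⊔ I.toLinearMap (-h) = 0
    rw [map_neg, hh, neg_zero, sup_idem]
  have hmem : V ⟨h ⊔ -h, hK⟩ ∈ ⨅ g, 𝓟 (V g) := mem_iInf_of_mem _ (mem_principal_self _)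
  filter_upwards [Ultrafilter.of_le _ hmem] with x hx
  have hx' : |ε⁻¹ * (f.1 x - I.toLinearMap f * 1)| < 1 := hx
  rw [abs_mul, abs_of_pos (inv_pos.2 hε), mul_one, inv_mul_lt_iff₀ hε, mul_one] at hx'
  exact hx'

/-- Every element of the spectrum is evaluation at a point of an elementary extension. -/
theorem exists_elementary_extension_of_mem_spectrumOver {I : RieszHom (interpSpace S A) ℝ}
    (hI : I ∈ spectrumOver S A) :
    ∃ (N : Type w) (_ : MetricSpace N) (S' : L.MetricStructure N) (j : M → N) (b : N),
      IsElementaryEmbedding S S' j ∧ ∀ φ : (L.withConstants A).Formula 1,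
        (S'.expand fun a : A => j a).val φ (fun _ => b) =
          I.toLinearMap ⟨interp S A φ, interp_mem S A φ⟩ := by
  obtain ⟨U, hU⟩ := exists_ultrafilter_tendsto hI
  have := S.boundedSpace
  -- The index set is `M` itself, so the ultrapower stays in the same universe. The class of the
  -- identity family is the required point: its coordinate values for `φ` are those of φ^M.
  refine ⟨Ultrapower U M, inferInstance, S.ultrapower U, fun a => ultraMk U fun _ => a,
    ultraMk U id, isElementaryEmbedding_ultrapower S U, fun φ => ?_⟩
  exact tendsto_nhds_unique
    (S.tendsto_ultrapower_expand_val U (fun a : A => (a : M)) φ fun _ => id)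
    (hU ⟨interp S A φ, interp_mem S A φ⟩)

/-- The set contains `φ = r` for the actual value `r` of each `φ`. A point realizing a larger type
thus gives every formula the same value, and so satisfies no further statements. -/
theorem statementsAt_mem_completeTypes {N : Type w} [MetricSpace N]
    {S' : (L.withConstants A).MetricStructure N}
    (hS' : ∀ s ∈ theoryOver S A, S'.Satisfies Fin.elim0 s) (b : N) :
    statementsAt S' b ∈ completeTypes S A := by
  refine ⟨⟨N, _, S', hS', b, fun s hs => hs⟩, fun q hq hle => ?_⟩
  obtain ⟨N', _, S'', -, b', hb'⟩ := hq
  have : statementsAt S' b = statementsAt S'' b' := statementsAt_eq_of_val_eq fun φ =>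
    (hb' (.eq φ (S'.val φ fun _ => b)) (hle rfl)).symm
  exact fun s hs => this ▸ hb' s hs

theorem exists_eq_statementsAt {p : Set ((L.withConstants A).Statement 1)}
    (hp : p ∈ completeTypes S A) :
    ∃ (N : Type w) (_ : MetricSpace N) (S' : (L.withConstants A).MetricStructure N) (b : N),
      (∀ s ∈ theoryOver S A, S'.Satisfies Fin.elim0 s) ∧ p = statementsAt S' b := by
  obtain ⟨N, _, S', hS', b, hb⟩ := hp.1
  exact ⟨N, _, S', b, hS', hp.eq_of_subset (statementsAt_mem_completeTypes hS' b).1 hb⟩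

/-- Formulas with the same interpretation in `M` have the same interpretation in every model of the
theory of `M` with parameters. -/
theorem val_eq_of_interp_eq {N : Type w} [MetricSpace N]
    {S' : (L.withConstants A).MetricStructure N}
    (hS' : ∀ s ∈ theoryOver S A, S'.Satisfies Fin.elim0 s) {φ ψ : (L.withConstants A).Formula 1}
    (h : interp S A φ = interp S A ψ) (b : N) :
    S'.val φ (fun _ => b) = S'.val ψ (fun _ => b) := by
  -- Equality of the interpretations is expressed by the closed statement `sup χ = 0`, which belongs
  -- to T_A and so transfers to `N`.
  let χ : (L.withConstants A).Formula 1 :=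
    .conn (k := 2) ⟨fun t => |t 0 - t 1|, by fun_prop⟩ ![φ, ψ]
  have hχ : ∀ {N : Type w} [MetricSpace N] (S' : (L.withConstants A).MetricStructure N) (b : N),
      S'.val χ (fun _ => b) = |S'.val φ (fun _ => b) - S'.val ψ (fun _ => b)| := fun _ _ => rfl
  have hsnoc : ∀ {N : Type w} (b : N), (Fin.snoc Fin.elim0 b : Fin 1 → N) = fun _ => b := by
    intro N b
    ext i
    rw [Fin.eq_zero i]
    exact Fin.snoc_last (α := fun _ => N) b Fin.elim0
  have hM : (S.over A).Satisfies Fin.elim0 (.eq (.sup χ) 0) := by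
    have h0 : ∀ a : M, (S.over A).val χ (fun _ => a) = 0 := fun a => by
      rw [hχ, abs_eq_zero, sub_eq_zero]
      exact congrFun h a
    simp [MetricStructure.Satisfies, MetricStructure.val, hsnoc, h0]
  have hN := hS' (.eq (.sup χ) 0) hM
  simp only [MetricStructure.Satisfies, MetricStructure.val, hsnoc] at hN
  obtain ⟨B, hB⟩ := exists_bound χ
  have hle : S'.val χ (fun _ => b) ≤ 0 := hN ▸ le_ciSup (f := fun b => S'.val χ fun _ => b)
    ⟨B, by rintro _ ⟨b, rfl⟩; exact (abs_le.1 (hB N S' _)).2⟩ b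
  rw [hχ] at hle
  exact sub_eq_zero.1 (abs_nonpos_iff.1 hle)

/-- An element of a model of the theory of `M` with parameters defines an element of the spectrum. -/
theorem exists_mem_spectrumOver_eq_val {N : Type w} [MetricSpace N]
    {S' : (L.withConstants A).MetricStructure N}
    (hS' : ∀ s ∈ theoryOver S A, S'.Satisfies Fin.elim0 s) (b : N) :
    ∃ I ∈ spectrumOver S A, ∀ φ : (L.withConstants A).Formula 1,
      I.toLinearMap ⟨interp S A φ, interp_mem S A φ⟩ = S'.val φ (fun _ => b) := by
  -- A formula is chosen for each function; `key` shows that the value at `b` does not depend on the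
  -- choice.
  choose g hg using fun f : interpSpace S A => f.2
  have key : ∀ (f : interpSpace S A) φ, interp S A φ = f.1 →
      S'.val (g f) (fun _ => b) = S'.val φ (fun _ => b) := fun f φ h =>
    val_eq_of_interp_eq hS' ((hg f).trans h.symm) b
  have key₂ : ∀ (op : C(Fin 2 → ℝ, ℝ)) (f₁ f₂ f : interpSpace S A),
      (∀ x, f.1 x = op ![f₁.1 x, f₂.1 x]) → S'.val (g f) (fun _ => b) =
        op ![S'.val (g f₁) (fun _ => b), S'.val (g f₂) (fun _ => b)] := by
    intro op f₁ f₂ f h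
    have hv : ∀ {N : Type w} [MetricSpace N] (S' : (L.withConstants A).MetricStructure N) (b : N),
        S'.val (.conn op ![g f₁, g f₂]) (fun _ => b) =
          op ![S'.val (g f₁) (fun _ => b), S'.val (g f₂) (fun _ => b)] := by
      intro N _ S' b
      rw [MetricStructure.val]
      congr 1
      ext i
      fin_cases i <;> rfl
    rw [key f (.conn op ![g f₁, g f₂]), hv]
    ext x
    rw [h, ← hg f₁, ← hg f₂]
    exact hv _ x
  let I : RieszHom (interpSpace S A) ℝ :=
    { toFun := fun f => S'.val (g f) fun _ => b
      map_add' := fun f₁ f₂ => key₂ ⟨fun t => t 0 + t 1, by fun_prop⟩ f₁ f₂ _ fun x => rfl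
      map_smul' := fun r f => key₂ ⟨fun t => r * t 0, by fun_prop⟩ f f _ fun x => rfl
      map_sup := fun f₁ f₂ => key₂ ⟨fun t => t 0 ⊔ t 1, by fun_prop⟩ f₁ f₂ _ fun x => rfl
      map_inf := fun f₁ f₂ => key₂ ⟨fun t => t 0 ⊓ t 1, by fun_prop⟩ f₁ f₂ _ fun x => rfl }
  refine ⟨I, ?_, fun φ => key _ φ rfl⟩
  -- The constant 1 is treated as a binary connective with two dummy arguments.
  exact key₂ ⟨fun _ => 1, by fun_prop⟩ 0 0 ⟨1, one_mem_interpSpace S A⟩ fun x => rfl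

/-- An elementary extension is a model of the theory with parameters. -/
theorem IsElementaryEmbedding.satisfies_theoryOver {N : Type w} [MetricSpace N]
    {S' : L.MetricStructure N} {j : M → N} (hj : IsElementaryEmbedding S S' j) :
    ∀ s ∈ theoryOver S A, (S'.expand fun a : A => j a).Satisfies Fin.elim0 s := by
  have h : ∀ φ : (L.withConstants A).Formula 0,
      (S'.expand fun a : A => j a).val φ Fin.elim0 = (S.over A).val φ Fin.elim0 := by
    intro φ
    rw [Subsingleton.elim (Fin.elim0 : Fin 0 → N) (j ∘ Fin.elim0)]
    exact hj.val_expand (fun a : A => (a : M)) φ Fin.elim0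
  rintro (⟨φ, r⟩ | ⟨φ, r⟩) hs <;>
    simpa only [theoryOver, Set.mem_ofPred_eq, MetricStructure.Satisfies, h] using hs

end Spectrum

end MetricLanguage

/-! ### The proposition -/

theorem mainTheorem7 (L : MetricLanguage.{u, v}) {M : Type w} [MetricSpace M]
    (S : L.MetricStructure M) (A : Set M) :
    (∃ Φ : MetricLanguage.completeTypes S A → MetricLanguage.spectrumOver S A,
      (∀ (p : MetricLanguage.completeTypes S A) (φ : (L.withConstants A).Formula 1) (r : ℝ),
        (Φ p).1.toLinearMap ⟨MetricLanguage.interp S A φ, MetricLanguage.interp_mem S A φ⟩ = r ↔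
          MetricLanguage.Statement.eq φ r ∈ p.1) ∧
      Function.Bijective Φ) ∧
    (∀ p : Set ((L.withConstants A).Statement 1),
      p ∈ MetricLanguage.completeTypes S A ↔
        ∃ (N : Type w) (_ : MetricSpace N) (S' : L.MetricStructure N) (j : M → N),
          MetricLanguage.IsElementaryEmbedding S S' j ∧
          ∃ a : N, p = MetricLanguage.typeOf S' A j a) := by
  -- The clause for `≥` is recorded too: a type contains both kinds of statements, and both are
  -- needed to recover `p` from its functional.
  have hex : ∀ p : MetricLanguage.completeTypes S A, ∃ I : MetricLanguage.spectrumOver S A,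
      (∀ φ r, I.1.toLinearMap ⟨MetricLanguage.interp S A φ, MetricLanguage.interp_mem S A φ⟩ = r ↔
        MetricLanguage.Statement.eq φ r ∈ p.1) ∧
      ∀ φ r, I.1.toLinearMap ⟨MetricLanguage.interp S A φ, MetricLanguage.interp_mem S A φ⟩ ≥ r ↔
        MetricLanguage.Statement.ge φ r ∈ p.1 := by
    rintro ⟨p, hp⟩
    obtain ⟨N, _, S', b, hS', rfl⟩ := MetricLanguage.exists_eq_statementsAt hp
    obtain ⟨I, hI, h⟩ := MetricLanguage.exists_mem_spectrumOver_eq_val hS' b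
    exact ⟨⟨I, hI⟩, fun φ r => by rw [h]; rfl, fun φ r => by rw [h]; rfl⟩
  choose Φ hΦ hΦ' using hex
  refine ⟨⟨Φ, hΦ, fun p q hpq => ?_, ?_⟩, fun p => ⟨fun hp => ?_, ?_⟩⟩
  · ext (⟨φ, r⟩ | ⟨φ, r⟩)
    · rw [← hΦ, ← hΦ, hpq]
    · rw [← hΦ', ← hΦ', hpq]
  · rintro ⟨I, hI⟩
    obtain ⟨N, _, S', j, b, hj, h⟩ :=
      MetricLanguage.exists_elementary_extension_of_mem_spectrumOver hI
    refine ⟨⟨_, MetricLanguage.statementsAt_mem_completeTypes hj.satisfies_theoryOver b⟩, ?_⟩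
    refine Subtype.ext (RieszHom.ext_apply ?_)
    rintro ⟨_, φ, rfl⟩
    -- By `h φ`, the statement `φ = I(φ^M)` holds at `b`, hence belongs to the type of `b`.
    exact (hΦ _ φ _).2 (h φ)
  · obtain ⟨N, _, S', j, b, hj, h⟩ :=
      MetricLanguage.exists_elementary_extension_of_mem_spectrumOver (Φ ⟨p, hp⟩).2
    refine ⟨N, _, S', j, hj, b, ?_⟩
    ext (⟨φ, r⟩ | ⟨φ, r⟩)
    · rw [← hΦ ⟨p, hp⟩, ← h]
      rfl
    · rw [← hΦ' ⟨p, hp⟩, ← h]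
      rfl
  · rintro ⟨N, _, S', j, hj, b, rfl⟩
    exact MetricLanguage.statementsAt_mem_completeTypes hj.satisfies_theoryOver b
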